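/- **Embedded graphs.** An embedded graph $\boldsymbol G$ is a cellular embedding of a finite graph $G$ in a compact surface, represented in the standard way by a rotation system with edge signatures. Loops, multiple edges, isolated vertices and disconnected or empty graphs are allowed; an isolated vertex is embedded in a sphere of its own. Thus every edge consists of two half-edges, the half-edges at each vertex are cyclically ordered (clockwise in a chosen local orientation at that vertex), and every edge has a signature, which is $1$ if the local orientations at its two ends agree along the edge and $-1$ otherwise. A cycle is 1-sided if it contains an odd number of edges of signature $-1$, and the surface is orientable if the local orientations at the vertices can be chosen so that they agree along every edge. **The jewel.** A flag of $\boldsymbol G$ is a half-edge together with one of its two sides (a triangle of the barycentric subdivision). The jewel $\mathbf L$ of $\boldsymbol G$ is the $4$-regular multigraph whose vertices are the flags, in which each flag $x$ is incident with one edge of each of the colors $\mathsf v,\mathsf f,\mathsf z,\mathsf a$: the edge of color $\mathsf v$ joins $x$ to the flag on the other side of the same half-edge; the edge of color $\mathsf f$ joins $x$ to the flag on the same side of the same edge at its other half; the edge of color $\mathsf z$ joins $x$ to the flag on the other side of the same edge at its other half; the edge of color $\mathsf a$ joins $x$ to the flag with which it shares a corner, that is, the facing side of the half-edge next to it around its vertex.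 Isolated vertices are ignored. For a walk $K$ in $\mathbf L$ let $v(K),f(K),z(K),a(K)$ be the numbers of edges of each color in $K$, counted with multiplicity, and put $\bar v=f+z+a$, $\bar f=v+z+a$, $\bar z=v+f+a$. For $\beta=(\beta_{\mathsf v},\beta_{\mathsf f},\beta_{\mathsf z})\in\mathbb Z_2^3$ let $\overline{\mathrm{CW}}(\mathbf L,\beta)$ be the condition that $(\beta_{\mathsf v}\bar v+\beta_{\mathsf f}\bar f+\beta_{\mathsf z}\bar z)(K)$ is even for every closed walk $K$ in $\mathbf L$. **The properties.** Property (0) always holds. The other seven properties of $\boldsymbol G$ are: 1. the underlying surface is orientable; 2. a cycle of $G$ is 1-sided if and only if it has odd length; 3. $G$ is bipartite; 4. $\boldsymbol G$ is directable: the edges can be directed so that every face boundary is a directed walk; 5. $\boldsymbol G$ is 2-face-colorable: the faces can be 2-colored so that the faces on the two sides of every edge have different colors; 6. when $\boldsymbol G$ and its dual $\boldsymbol G^*$ are embedded together in the natural way in their common surface $\Sigma$, the regions of $\Sigma-(\boldsymbol G\cup\boldsymbol G^*)$ can be properly 2-colored; 7. the edges can be 2-colored so that the colors alternate around every vertex and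 around every face. For $p\in\{0,\dots,7\}$ let $b(p)\in\mathbb Z_2^3$ be the vector of the three binary digits of $p$ (so $b(6)=(1,1,0)$), and let $\oplus$ be the corresponding addition of numbers (bitwise exclusive or). The points of the Fano plane $F$ are the nonzero vectors of $\mathbb Z_2^3$, and its $d$-dimensional projective subspaces are the $(d+1)$-dimensional vector subspaces of $\mathbb Z_2^3$ with $0$ removed. **Theorem (Fano Framework).** The map $b$ is a bijection from $\{1,\dots,7\}$ to the points of $F$, and for every embedded graph $\boldsymbol G$ with jewel $\mathbf L$ the following hold. * For every $p\in\{0,\dots,7\}$, $\boldsymbol G$ has property $(p)$ if and only if $\overline{\mathrm{CW}}(\mathbf L,b(p))$ holds. * $X=\{\beta\in\mathbb Z_2^3:\overline{\mathrm{CW}}(\mathbf L,\beta)\text{ holds}\}$ is a vector subspace of $\mathbb Z_2^3$, and $X\setminus\{0\}$ is a projective subspace of $F$. Consequently $\{b(p): 1\le p\le 7,\ \boldsymbol G\text{ has property }(p)\}$ is a projective subspace of $F$. * (A) Exactly zero, one, three or seven of the properties $(1),\dots,(7)$ hold. In particular, if two of them hold then so does a third, and if at least four of them hold then all seven do. * (B)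 If $a,b,c\in\{1,\dots,7\}$ are distinct and $a\oplus b\oplus c=0$, then any two of the properties $(a),(b),(c)$ imply the third. * (C) If $a,b,c\in\{1,\dots,7\}$ are distinct and $a\oplus b\oplus c\ne0$, then the properties $(a),(b),(c)$ together imply all seven properties. -/

import Mathlib

namespace FanoFramework

/-! ### Walks, cycles and bipartiteness in multigraphs -/

/-- A walk `u = v₀ e₁ v₁ e₂ v₂ … e_ℓ v_ℓ = w` in a multigraph: the ends of `e_i` are
`v_{i-1}` and `v_i`. -/
inductive Walk {α β : Type*} (H : Graph α β) : α → α → Type _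
  | nil (u : α) (hu : u ∈ H.vertexSet) : Walk H u u
  | cons {u v w : α} (e : β) (h : H.IsLink e u v) (p : Walk H v w) : Walk H u w

namespace Walk

variable {α β : Type*} {H : Graph α β}

/-- The list of edges of a walk, with multiplicity. -/
def edges : {u w : α} → Walk H u w → List β
  | _, _, nil _ _ => []
  | _, _, cons e _ p => e :: p.edges

/-- The list of vertices of a walk, with multiplicity. -/
def support : {u w : α} → Walk H u w → List α
  | _, _, nil u _ => [u]
  | u, _, cons _ _ p => u :: p.support

/-- A closed walk is a cycle if it is nontrivial, repeats no edge, and repeats no vertex except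
that its last vertex is its first.  Loops and pairs of parallel edges give cycles of length
`1` and `2`. -/
def IsCycle {u : α} (K : Walk H u u) : Prop :=
  K.edges ≠ [] ∧ K.edges.Nodup ∧ K.support.tail.Nodup

end Walk

/-- A multigraph is bipartite if its vertices can be 2-colored so that the ends of every edge
have different colors (so there are no loops). -/
def Bipartite {α β : Type*} (H : Graph α β) : Prop :=
  ∃ col : α → Bool, ∀ e x y, H.IsLink e x y → col x ≠ col y

/-! ### Jewels -/

/-- The four edge colors of a jewel: vertex, facial, zigzag and auxiliary. -/
inductive Color
  | v
  | f
  | z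
  | a
  deriving DecidableEq

/-- A jewel: a finite 4-regular (multi)graph with a proper 4-edge-coloring such that every
component of the 3-factor formed by the edges of colors `v`, `f`, `z` is a complete graph `K₄`.
The values of `color` outside the edge set are irrelevant. -/
structure Jewel (α β : Type*) where
  /-- the underlying graph -/
  graph : Graph α β
  /-- the edge coloring -/
  color : β → Color
  vertex_finite : graph.vertexSet.Finite
  edge_finite : graph.edgeSet.Finite
  loopless : ∀ e x, ¬ graph.IsLink e x x
  /-- every vertex is incident with exactly one edge of each of the four colors -/
  proper_regular : ∀ x ∈ graph.vertexSet, ∀ c, ∃! e, color e = c ∧ graph.Inc e x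
  /-- every vertex lies in an e-simplex: a set of four vertices that no edge of color `v`, `f`
  or `z` leaves, any two of which are joined by exactly one edge of color `v`, `f` or `z` -/
  e_simplex : ∀ x ∈ graph.vertexSet, ∃ S : Set α, x ∈ S ∧ S.ncard = 4 ∧
    (∀ y ∈ S, ∀ e w, graph.IsLink e y w → color e ≠ Color.a → w ∈ S) ∧
    (∀ y ∈ S, ∀ w ∈ S, y ≠ w → ∃! e, graph.IsLink e y w ∧ color e ≠ Color.a)

namespace Jewel

variable {α β : Type*} (L : Jewel α β)

/-- The number of edges of color `c` in a walk, counted with multiplicity. -/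
def num (c : Color) {u w : α} (K : Walk L.graph u w) : ℕ :=
  (K.edges.map L.color).count c

/-- `v̄ = f + z + a`. -/
def vBar {u w : α} (K : Walk L.graph u w) : ℕ :=
  L.num Color.f K + L.num Color.z K + L.num Color.a K

/-- `f̄ = v + z + a`. -/
def fBar {u w : α} (K : Walk L.graph u w) : ℕ :=
  L.num Color.v K + L.num Color.z K + L.num Color.a K

/-- `z̄ = v + f + a`. -/
def zBar {u w : α} (K : Walk L.graph u w) : ℕ :=
  L.num Color.v K + L.num Color.f K + L.num Color.a K

/-- For `b = (b_v, b_f, b_z)`, the condition that `(b_v v̄ + b_f f̄ + b_z z̄)(K)` is even for every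
closed walk `K` in the jewel. -/
def ClosedWalkCondition (b : Fin 3 → ZMod 2) : Prop :=
  ∀ (u : α) (K : Walk L.graph u u),
    Even ((b 0).val * L.vBar K + (b 1).val * L.fBar K + (b 2).val * L.zBar K)

end Jewel

/-! ### Embedded graphs -/

/-- Each edge `e` has the two half-edges `(e, false)` and `(e, true)`. -/
abbrev HalfEdge (E : Type*) := E × Bool

/-- The other half of the same edge. -/
def HalfEdge.opp {E : Type*} (h : HalfEdge E) : HalfEdge E := (h.1, !h.2)

/-- A cellular embedding, in a compact surface, of a graph with vertex set `V` and edge set `E`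
(loops, multiple edges, isolated vertices and several components are allowed), given by a
rotation system with edge signatures.

The half-edge `h` is attached to the vertex `root h`.  The half-edges at each vertex are cyclically
permuted by `rot`, which lists them in the clockwise order of some local orientation at that vertex.
The signature of an edge is `1` if the local orientations chosen at its two ends agree
along the edge, and `-1` otherwise. A vertex without half-edges is embedded in a sphere of
its own. -/
structure EmbeddedGraph (V E : Type*) where
  root : HalfEdge E → V
  rot : Equiv.Perm (HalfEdge E)
  sameCycle_rot_iff : ∀ h k, rot.SameCycle h k ↔ root h = root k
  sign : E → ℤˣ

/-- A flag (a triangle of the barycentric subdivision) is a half-edge `h` together with one of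
its two sides: `(h, 1)` is the side facing `rot h`, and `(h, -1)` is the side facing `rot⁻¹ h`. -/
abbrev Flag (E : Type*) := HalfEdge E × ℤˣ

namespace EmbeddedGraph

variable {V E : Type*} (G : EmbeddedGraph V E)

/-- The underlying graph. -/
def graph : Graph V E where
  vertexSet := Set.univ
  IsLink e x y := ∃ i, G.root (e, i) = x ∧ G.root (e, !i) = y
  isLink_symm := by
    intro e _
    constructor
    rintro x y ⟨i, rfl, rfl⟩
    exact ⟨!i, rfl, by simp⟩
  eq_or_eq_of_isLink_of_isLink := by
    rintro e x y v w ⟨i, rfl, rfl⟩ ⟨j, rfl, rfl⟩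
    cases i <;> cases j <;> simp
  left_mem_of_isLink := by
    intros
    trivial

/-- The flag that is adjacent to a given flag, in the barycentric subdivision, across its side
of color `v` (half of an edge of the graph), `f` (half of an edge of the dual graph) or `a` (the
side in the corner between two consecutive half-edges at a vertex).  Thus color `v` leads to the
other side of the same half-edge, color `f` to the same side of the edge at its other half, and
color `a` to the facing side of the next half-edge around the vertex.  Color `z` is for the
diagonal of the square formed by the colors `v` and `f`. -/
def flip : Color → Flag E → Flag E
  | Color.v, x => (x.1, -x.2)
  | Color.f, x => (x.1.opp, -(x.2 * G.sign x.1.1))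
  | Color.z, x => (x.1.opp, x.2 * G.sign x.1.1)
  | Color.a, x => if x.2 = 1 then (G.rot x.1, -1) else (G.rot⁻¹ x.1, 1)

theorem flip_flip (c : Color) (x : Flag E) : G.flip c (G.flip c x) = x := by
  obtain ⟨⟨e, i⟩, s⟩ := x
  cases c
  · simp [flip]
  · simp [flip, HalfEdge.opp, mul_assoc]
  · simp [flip, HalfEdge.opp, mul_assoc]
  · rcases Int.units_eq_one_or s with rfl | rfl <;> simp [flip]

theorem flip_ne (c : Color) (x : Flag E) : G.flip c x ≠ x := by
  obtain ⟨⟨e, i⟩, s⟩ := x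
  cases c
  · rcases Int.units_eq_one_or s with rfl | rfl <;> simp [flip]
  · simp [flip, HalfEdge.opp]
  · simp [flip, HalfEdge.opp]
  · rcases Int.units_eq_one_or s with rfl | rfl <;> simp [flip]

/-- The graph whose vertices are the flags and in which, for every color `c`, every flag `x` is
joined to `G.flip c x` by one edge, namely `(c, s(x, G.flip c x))`. -/
def jewelGraph : Graph (Flag E) (Color × Sym2 (Flag E)) where
  vertexSet := Set.univ
  IsLink e x y := e.2 = s(x, y) ∧ y = G.flip e.1 x
  isLink_symm := by
    intro e _
    constructor
    rintro x y ⟨h, rfl⟩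
    exact ⟨by rw [h, Sym2.eq_swap], (G.flip_flip _ _).symm⟩
  eq_or_eq_of_isLink_of_isLink := by
    rintro e x y v w ⟨h, -⟩ ⟨h', -⟩
    rw [h, Sym2.eq_iff] at h'
    tauto
  left_mem_of_isLink := by
    intros
    trivial

/-- The jewel of an embedded graph.  Vertices without half-edges are ignored. -/
def jewel [Finite E] : Jewel (Flag E) (Color × Sym2 (Flag E)) where
  graph := G.jewelGraph
  color e := e.1
  vertex_finite := Set.toFinite _
  edge_finite := by
    have : Finite Color := Finite.of_surjective
      (fun i : Fin 4 => (![Color.v, Color.f, Color.z, Color.a] : Fin 4 → Color) i)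
      (by rintro (_ | _ | _ | _); exacts [⟨0, rfl⟩, ⟨1, rfl⟩, ⟨2, rfl⟩, ⟨3, rfl⟩])
    exact Set.toFinite _
  loopless := by
    rintro e x ⟨-, h⟩
    exact G.flip_ne _ _ h.symm
  proper_regular := by
    intro x _ c
    refine ⟨(c, s(x, G.flip c x)), ⟨rfl, G.flip c x, rfl, rfl⟩, ?_⟩
    rintro ⟨d, t⟩ ⟨rfl, y, h, rfl⟩
    simp only at h
    rw [h]
  e_simplex := by
    rintro ⟨⟨e, i⟩, s⟩ _
    refine ⟨{x | x.1.1 = e}, rfl, ?_, ?_, ?_⟩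
    · have h : {x : Flag E | x.1.1 = e}
          = Set.range (fun p : Bool × ℤˣ => (((e, p.1), p.2) : Flag E)) := by
        ext ⟨⟨e', j⟩, t⟩
        simp [eq_comm]
      rw [h, ← Set.image_univ, Set.ncard_image_of_injective, Set.ncard_univ,
        Nat.card_eq_fintype_card]
      · rfl
      · rintro ⟨j, t⟩ ⟨k, r⟩ h
        simpa using h
    · rintro y hy ⟨c, t⟩ w ⟨-, rfl⟩ hc
      cases c
      · exact hy
      · exact hy
      · exact hy
      · exact absurd rfl hc
    · rintro ⟨⟨e₁, j⟩, t⟩ h₁ ⟨⟨e₂, k⟩, r⟩ h₂ hne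
      obtain rfl : e₁ = e := h₁
      obtain rfl : e₂ = e₁ := h₂
      have key : ∃! c, c ≠ Color.a ∧ ((e₂, k), r) = G.flip c ((e₂, j), t) := by
        rcases Int.units_eq_one_or t with rfl | rfl <;>
          rcases Int.units_eq_one_or r with rfl | rfl <;>
          rcases Int.units_eq_one_or (G.sign e₂) with hs | hs <;>
          cases j <;> cases k <;>
          first
          | exact absurd rfl hne
          | refine ⟨Color.v, by simp [flip], ?_⟩
            rintro (_ | _ | _ | _) <;> simp [flip, HalfEdge.opp, hs]
            done
          | refine ⟨Color.f, by simp [flip, HalfEdge.opp, hs], ?_⟩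
            rintro (_ | _ | _ | _) <;> simp [flip, HalfEdge.opp, hs]
            done
          | refine ⟨Color.z, by simp [flip, HalfEdge.opp, hs], ?_⟩
            rintro (_ | _ | _ | _) <;> simp [flip, HalfEdge.opp, hs]
      obtain ⟨c, ⟨hc, hw⟩, huniq⟩ := key
      refine ⟨(c, s(((e₂, j), t), ((e₂, k), r))), ⟨⟨rfl, hw⟩, hc⟩, ?_⟩
      rintro ⟨d, q⟩ ⟨⟨hq, hd⟩, hd'⟩
      obtain rfl := huniq d ⟨hd', hd⟩
      simp only at hq
      rw [hq]

/-! ### The seven properties -/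

/-- Orientability of the surface: a clockwise direction can be chosen at every vertex so that the
choices agree along every edge.  Here `o u` tells whether the clockwise direction chosen
at `u` is the local orientation underlying `rot`.  The faces, being disks, and the vertices
without half-edges, embedded in spheres, impose no condition. -/
def Orientable : Prop :=
  ∃ o : V → ℤˣ, ∀ e x y, G.graph.IsLink e x y → o x * G.sign e * o y = 1

/-- A cycle is 1-sided if it has an odd number of edges of signature `-1`. -/
def OneSided {u : V} (C : Walk G.graph u u) : Prop :=
  (C.edges.map G.sign).prod = -1

/-- A cycle is 1-sided if and only if its length is odd. -/
def OneSidedIffOdd : Prop :=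
  ∀ (u : V) (C : Walk G.graph u u), C.IsCycle → (G.OneSided C ↔ Odd C.edges.length)

/-- The facial walk that starts at the flag `x`, as the sequence of half-edges along which it
leaves the successive vertices.  After following an edge along one of its sides (color `f`),
the walk turns around the corner that it meets there (color `a`).  The sequence is
periodic, one period being the closed walk that bounds the face. -/
def facialWalk (x : Flag E) (n : ℕ) : HalfEdge E :=
  ((fun y => G.flip Color.a (G.flip Color.f y))^[n] x).1

/-- The edges can be directed so that every face boundary is a directed walk.  Here
`(e, tail e)` is the half-edge at the tail of `e`, so a walk that leaves a vertex along the
half-edge `h` follows the direction of the edge `h.1` if and only if `h.2 = tail h.1`.  A facial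
walk, traversed in one of the two ways, has to follow all directions or to oppose all of them. -/
def Directable : Prop :=
  ∃ tail : E → Bool, ∀ x : Flag E,
    (∀ n, (G.facialWalk x n).2 = tail (G.facialWalk x n).1) ∨
    (∀ n, (G.facialWalk x n).2 ≠ tail (G.facialWalk x n).1)

/-- The faces: the classes of flags generated by adjacency across the sides of colors `f` and `a`,
and one face for every vertex without half-edges. -/
def Face : Type _ :=
  Quot (fun x y : Flag E => y = G.flip Color.f x ∨ y = G.flip Color.a x) ⊕
    {u : V // ∀ h, G.root h ≠ u}

/-- The face containing a flag. -/
def faceOf (x : Flag E) : G.Face := Sum.inl (Quot.mk _ x)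

/-- The faces can be 2-colored so that the faces on the two sides of every edge have different
colors. -/
def TwoFaceColorable : Prop :=
  ∃ col : G.Face → Bool, ∀ x, col (G.faceOf x) ≠ col (G.faceOf (G.flip Color.v x))

/-- The regions of the surface minus the union of the graph and its dual: each of them consists
of two flags that are adjacent across a side of color `a`, except that a vertex without half-edges
gives one region, the sphere minus this vertex and its dual vertex. -/
def Region : Type _ :=
  Quot (fun x y : Flag E => y = G.flip Color.a x) ⊕ {u : V // ∀ h, G.root h ≠ u}

/-- The region containing a flag. -/
def regionOf (x : Flag E) : G.Region := Sum.inl (Quot.mk _ x)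

/-- The regions of the surface minus the union of the graph and its dual can be properly
2-colored: regions that share half of an edge of the graph, or half of an edge of
the dual, have different colors. -/
def RegionsTwoColorable : Prop :=
  ∃ col : G.Region → Bool, ∀ x,
    col (G.regionOf x) ≠ col (G.regionOf (G.flip Color.v x)) ∧
    col (G.regionOf x) ≠ col (G.regionOf (G.flip Color.f x))

/-- The edges can be 2-colored so that the colors alternate around every vertex and around
every face: consecutive half-edges in the rotation at a vertex, and consecutive edges of a facial
walk, have different colors. -/
def AlternatingEdgeColorable : Prop :=
  ∃ col : E → Bool,
    (∀ h, col h.1 ≠ col (G.rot h).1) ∧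
    (∀ x n, col (G.facialWalk x n).1 ≠ col (G.facialWalk x (n + 1)).1)

/-- Property `(p)`; property `(0)` always holds. -/
def Property : Fin 8 → Prop
  | 0 => True
  | 1 => G.Orientable
  | 2 => G.OneSidedIffOdd
  | 3 => Bipartite G.graph
  | 4 => G.Directable
  | 5 => G.TwoFaceColorable
  | 6 => G.RegionsTwoColorable
  | 7 => G.AlternatingEdgeColorable

end EmbeddedGraph

/-! ### The Fano plane -/

/-- The three binary digits of `p`, as a vector; for example `6` gives `(1, 1, 0)`. -/
def binVec (p : Fin 8) : Fin 3 → ZMod 2 :=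
  ![((p.val / 4 : ℕ) : ZMod 2), ((p.val / 2 : ℕ) : ZMod 2), (p.val : ZMod 2)]

/-- The points of the Fano plane are the nonzero vectors of `ℤ₂³`.  A `d`-dimensional projective
subspace is a `(d+1)`-dimensional vector subspace with `0` removed. -/
def IsProjectiveSubspace (d : ℤ) (S : Set (Fin 3 → ZMod 2)) : Prop :=
  ∃ W : Submodule (ZMod 2) (Fin 3 → ZMod 2),
    (Module.finrank (ZMod 2) W : ℤ) = d + 1 ∧ S = (W : Set (Fin 3 → ZMod 2)) \ {0}

end FanoFramework

/-! Modulo 2, the number attached to a closed walk by `b` is a sum of edge weights that depend only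
on the colors (`colorWeight`). Such a sum vanishes on all closed walks if and only if the weights
are the differences of a potential `φ` on the flags (`closed_weight_zero_iff_potential`). Potentials
can be added, so the admissible `b` form a subspace, `potentialSpace`.

Each of the seven properties is itself the existence of a potential. Since color `z` is the
composite of `f` and `v`, only the changes of `φ` across `v`, `f`, `a` matter (`hasPotential_iff`),
and the seven points `b` give the seven nonzero triples of changes: 111, 101, 010, 011, 100, 110,
001 for the properties 1 to 7. A face coloring, for example, is a function of the flags that changes
across `v` only. Property 2 alone is not local; it needs the fact that cycles control all closed
walks (`closed_weight_zero_of_cycles`).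

The rest is linear algebra: a subspace of dimension `d ≤ 3` has `2 ^ d - 1` nonzero vectors, and
`binVec` turns exclusive or into addition. -/

namespace FanoFramework

/-! ### Potentials of edge weights -/

namespace Walk

variable {α β : Type*} {H : Graph α β}

/-- The sum of the weights of the edges of a walk. -/
def weight (wt : β → ZMod 2) {u w : α} (K : Walk H u w) : ZMod 2 :=
  (K.edges.map wt).sum

@[simp] theorem weight_nil (wt : β → ZMod 2) (u : α) (hu : u ∈ H.vertexSet) :
    (nil u hu : Walk H u u).weight wt = 0 := rfl

@[simp] theorem weight_cons (wt : β → ZMod 2) {u v w : α} (e : β) (h : H.IsLink e u v)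
    (p : Walk H v w) : (cons e h p).weight wt = wt e + p.weight wt := by
  simp [weight, edges]

theorem exists_append (wt : β → ZMod 2) {u v w : α} (p : Walk H u v) (q : Walk H v w) :
    ∃ r : Walk H u w, r.weight wt = p.weight wt + q.weight wt := by
  induction p with
  | nil u hu => exact ⟨q, by simp⟩
  | cons e h p ih =>
    obtain ⟨r, hr⟩ := ih q
    exact ⟨cons e h r, by simp [hr, add_assoc]⟩

theorem exists_reverse (wt : β → ZMod 2) {u w : α} (p : Walk H u w) :
    ∃ r : Walk H w u, r.weight wt = p.weight wt := by
  induction p with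
  | nil u hu => exact ⟨nil u hu, rfl⟩
  | cons e h p ih =>
    obtain ⟨r, hr⟩ := ih
    obtain ⟨s, hs⟩ := exists_append wt r (cons e h.symm (nil _ h.left_mem))
    exact ⟨s, by simp [hs, hr, add_comm]⟩

theorem weight_eq_of_potential (wt : β → ZMod 2) (φ : α → ZMod 2)
    (hφ : ∀ e x y, H.IsLink e x y → φ y = φ x + wt e) {u w : α} (p : Walk H u w) :
    φ w = φ u + p.weight wt := by
  induction p with
  | nil u hu => simp
  | cons e h p ih => rw [ih, hφ _ _ _ h, weight_cons, add_assoc]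

/-- Edge weights come from a potential if and only if every closed walk has weight `0`. -/
theorem closed_weight_zero_iff_potential (wt : β → ZMod 2) :
    (∀ (u : α) (K : Walk H u u), K.weight wt = 0) ↔
      ∃ φ : α → ZMod 2, ∀ e x y, H.IsLink e x y → φ y = φ x + wt e := by
  constructor
  · intro hK
    -- Equality is added because a point outside `H.vertexSet` carries no walk, not even a trivial
    -- one.
    let S : Setoid α :=
      { r := fun x y => x = y ∨ Nonempty (Walk H x y)
        iseqv :=
          { refl := fun x => Or.inl rfl
            symm := by
              rintro x y (rfl | ⟨⟨p⟩⟩)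
              · exact Or.inl rfl
              · exact Or.inr ⟨(exists_reverse wt p).choose⟩
            trans := by
              rintro x y z (rfl | ⟨⟨p⟩⟩) (rfl | ⟨⟨q⟩⟩)
              · exact Or.inl rfl
              · exact Or.inr ⟨q⟩
              · exact Or.inr ⟨p⟩
              · exact Or.inr ⟨(exists_append wt p q).choose⟩ } }
    have base : ∀ x ∈ H.vertexSet, Nonempty (Walk H (Quotient.mk S x).out x) := by
      intro x hx
      rcases Quotient.mk_out (s := S) x with h | h
      · rw [h]
        exact ⟨nil x hx⟩
      · exact h
    classical
    -- The potential of `x` is the weight of a chosen walk to `x` from the representative of its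
    -- component.
    refine ⟨fun x => if hx : x ∈ H.vertexSet then (base x hx).some.weight wt else 0, ?_⟩
    intro e x y h
    simp only [h.left_mem, h.right_mem, dif_pos]
    have hxy : Quotient.mk S x = Quotient.mk S y :=
      Quotient.sound (s := S) (Or.inr ⟨cons e h (nil y h.right_mem)⟩)
    generalize (base x h.left_mem).some = p
    generalize (base y h.right_mem).some = q
    revert q
    -- With a common representative, `p`, the edge `e` and the reverse of `q` form a closed walk.
    rw [← hxy]
    intro q
    obtain ⟨r, hr⟩ := exists_reverse wt q
    obtain ⟨s, hs⟩ := exists_append wt p (cons e h r)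
    rw [hK, weight_cons, hr, ← add_assoc] at hs
    exact (CharTwo.add_eq_zero.1 hs.symm).symm
  · rintro ⟨φ, hφ⟩ u K
    simpa using weight_eq_of_potential wt φ hφ K

/-! ### Reduction of closed walks to cycles -/

theorem left_mem_support {u w : α} (p : Walk H u w) : u ∈ p.support := by
  cases p <;> simp [support]

theorem mem_support_of_mem_edges {u w : α} (p : Walk H u w) {e : β} (he : e ∈ p.edges)
    {x y : α} (h : H.IsLink e x y) : x ∈ p.support := by
  induction p with
  | nil u hu => simp [edges] at he
  | cons e' h' p ih =>
    rcases List.mem_cons.1 he with rfl | he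
    · rcases h.left_eq_or_eq h' with rfl | rfl
      · simp [support]
      · simp [support, left_mem_support p]
    · simp [support, ih he]

theorem edges_nodup_of_support_nodup {u w : α} (p : Walk H u w) (hp : p.support.Nodup) :
    p.edges.Nodup := by
  induction p with
  | nil u hu => simp [edges]
  | cons e h p ih =>
    simp only [support, List.nodup_cons] at hp
    simp only [edges, List.nodup_cons]
    exact ⟨fun he => hp.1 (mem_support_of_mem_edges p he h), ih hp.2⟩

theorem eq_nil_of_support_nodup {u : α} (p : Walk H u u) (hp : p.support.Nodup) :
    p.edges = [] := by
  have key : ∀ {u w : α} (p : Walk H u w), w ∈ p.support := by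
    intro u w p
    induction p with
    | nil u hu => simp [support]
    | cons e h p ih => simp [support, ih]
  cases p with
  | nil u hu => rfl
  | cons e h p =>
    simp only [support, List.nodup_cons] at hp
    exact absurd (key p) hp.1

/-- Serves to cut a path at the vertex to which a new edge returns: `q` and the new edge close up,
and `r` remains as the shortened path. -/
theorem exists_split (wt : β → ZMod 2) {u v w : α} (p : Walk H v w) (hp : p.support.Nodup)
    (hu : u ∈ p.support) : ∃ (q : Walk H v u) (r : Walk H u w),
      q.support.Nodup ∧ r.support.Nodup ∧ q.support ⊆ p.support ∧
        p.weight wt = q.weight wt + r.weight wt := by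
  induction p with
  | nil v hv =>
    obtain rfl : u = v := by simpa [support] using hu
    exact ⟨nil u hv, nil u hv, hp, hp, List.Subset.refl _, by simp⟩
  | @cons v x w e h p ih =>
    by_cases huv : u = v
    · subst huv
      exact ⟨nil u h.left_mem, cons e h p, by simp [support], hp, by simp [support], by simp⟩
    · have hp' := hp
      simp only [support, List.nodup_cons] at hp'
      obtain ⟨q, r, hq, hr, hs, hwt⟩ := ih hp'.2 (by simpa [support, huv] using hu)
      refine ⟨cons e h q, r, ?_, hr, ?_, by simp [hwt, add_assoc]⟩
      · simp only [support, List.nodup_cons]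
        exact ⟨fun hm => hp'.1 (hs hm), hq⟩
      · simpa [support] using List.subset_cons_of_subset _ hs

/-- An edge that joins the ends of a path closes it to a cycle, unless the path already uses this
edge. In that case the path is this edge alone, and its weight counted twice is `0`. -/
theorem weight_cons_path_eq_zero (wt : β → ZMod 2)
    (hC : ∀ (u : α) (C : Walk H u u), C.IsCycle → C.weight wt = 0) {u v : α} (e : β)
    (h : H.IsLink e u v) (q : Walk H v u) (hq : q.support.Nodup) :
    (cons e h q).weight wt = 0 := by
  by_cases he : e ∈ q.edges
  · cases q with
    | nil u hu => simp [edges] at he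
    | cons e' h' q =>
      simp only [support, List.nodup_cons] at hq
      rcases List.mem_cons.1 he with rfl | he
      · rcases h.symm.eq_and_eq_or_eq_and_eq h' with ⟨-, rfl⟩ | ⟨hv, -⟩
        · simp [weight, edges, eq_nil_of_support_nodup q hq.2, CharTwo.add_self_eq_zero]
        · have hv0 := left_mem_support q
          exact absurd (by rwa [hv]) hq.1
      · exact absurd (mem_support_of_mem_edges q he h.symm) hq.1
  · exact hC u _ ⟨by simp [edges],
      by simpa [edges] using ⟨he, edges_nodup_of_support_nodup q hq⟩, by simpa [support] using hq⟩

/-- Induction on the walk: when a prepended edge starts at a vertex that the path already visits,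
the closed piece so formed has weight `0` and can be dropped. -/
theorem exists_path (wt : β → ZMod 2)
    (hC : ∀ (u : α) (C : Walk H u u), C.IsCycle → C.weight wt = 0) {u w : α} (p : Walk H u w) :
    ∃ q : Walk H u w, q.support.Nodup ∧ q.weight wt = p.weight wt := by
  induction p with
  | nil u hu => exact ⟨nil u hu, by simp [support], rfl⟩
  | @cons u v w e h p ih =>
    obtain ⟨q, hq, hwt⟩ := ih
    by_cases hu : u ∈ q.support
    · obtain ⟨r, s, hr, hs, -, hrs⟩ := exists_split wt q hq hu
      refine ⟨s, hs, ?_⟩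
      have h0 := weight_cons_path_eq_zero wt hC e h r hr
      rw [weight_cons] at h0
      rw [weight_cons, ← hwt, hrs, ← add_assoc, h0, zero_add]
    · exact ⟨cons e h q, by simpa [support] using ⟨hu, hq⟩, by simp [hwt]⟩

/-- Every closed walk has weight `0` if every cycle has. -/
theorem closed_weight_zero_of_cycles (wt : β → ZMod 2)
    (hC : ∀ (u : α) (C : Walk H u u), C.IsCycle → C.weight wt = 0) (u : α) (K : Walk H u u) :
    K.weight wt = 0 := by
  obtain ⟨q, hq, hwt⟩ := exists_path wt hC K
  rw [← hwt, weight, eq_nil_of_support_nodup q hq]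
  rfl

end Walk

/-! ### The closed walk condition as existence of a potential -/

/-- The weight of a color in `b_v v̄ + b_f f̄ + b_z z̄`. -/
def colorWeight (b : Fin 3 → ZMod 2) : Color → ZMod 2
  | Color.v => b 1 + b 2
  | Color.f => b 0 + b 2
  | Color.z => b 0 + b 1
  | Color.a => b 0 + b 1 + b 2

theorem Jewel.cast_bars_eq_weight {α β : Type*} (L : Jewel α β) (b : Fin 3 → ZMod 2) {u w : α}
    (K : Walk L.graph u w) :
    (((b 0).val * L.vBar K + (b 1).val * L.fBar K + (b 2).val * L.zBar K : ℕ) : ZMod 2) =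
      K.weight (fun e => colorWeight b (L.color e)) := by
  induction K with
  | nil u hu => simp [vBar, fBar, zBar, num, Walk.edges]
  | cons e h p ih =>
    rw [Walk.weight_cons, ← ih]
    simp only [vBar, fBar, zBar, num, Walk.edges, List.map_cons, List.count_cons]
    cases L.color e <;> simp [colorWeight] <;> ring

theorem Jewel.closedWalkCondition_iff {α β : Type*} (L : Jewel α β) (b : Fin 3 → ZMod 2) :
    L.ClosedWalkCondition b ↔
      ∀ (u : α) (K : Walk L.graph u u), K.weight (fun e => colorWeight b (L.color e)) = 0 := by
  unfold ClosedWalkCondition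
  simp_rw [← ZMod.natCast_eq_zero_iff_even, cast_bars_eq_weight]

namespace EmbeddedGraph

variable {V E : Type*} (G : EmbeddedGraph V E)

/-- The weights of the colors given by `b` come from a potential on the flags. -/
def HasPotential (b : Fin 3 → ZMod 2) : Prop :=
  ∃ φ : Flag E → ZMod 2, ∀ c x, φ (G.flip c x) = φ x + colorWeight b c

theorem closedWalkCondition_iff_hasPotential [Finite E] (b : Fin 3 → ZMod 2) :
    G.jewel.ClosedWalkCondition b ↔ G.HasPotential b := by
  rw [Jewel.closedWalkCondition_iff, Walk.closed_weight_zero_iff_potential]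
  refine exists_congr fun φ => ⟨fun h c x => ?_, ?_⟩
  · exact h (c, s(x, G.flip c x)) x (G.flip c x) ⟨rfl, rfl⟩
  · rintro h ⟨c, t⟩ x y ⟨-, rfl⟩
    exact h c x

/-- The vectors that satisfy the closed walk condition. -/
def potentialSpace : Submodule (ZMod 2) (Fin 3 → ZMod 2) where
  carrier := {b | G.HasPotential b}
  zero_mem' := ⟨0, by rintro (_ | _ | _ | _) x <;> simp [colorWeight]⟩
  add_mem' := by
    rintro b b' ⟨φ, h⟩ ⟨φ', h'⟩
    refine ⟨φ + φ', fun c x => ?_⟩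
    simp only [Pi.add_apply, h, h']
    cases c <;> simp only [colorWeight, Pi.add_apply] <;> ring
  smul_mem' := by
    rintro r b ⟨φ, h⟩
    refine ⟨r • φ, fun c x => ?_⟩
    simp only [Pi.smul_apply, h, smul_eq_mul]
    cases c <;> simp only [colorWeight, Pi.smul_apply, smul_eq_mul] <;> ring

theorem mem_potentialSpace {b : Fin 3 → ZMod 2} : b ∈ G.potentialSpace ↔ G.HasPotential b :=
  Iff.rfl

/-! ### Reduction to the colors `v`, `f`, `a`, and descent from half-edges to vertices. -/

theorem flip_z (x : Flag E) : G.flip Color.z x = G.flip Color.v (G.flip Color.f x) := by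
  simp [flip]

/-- The condition for `z` follows from those for `v` and `f`, because `(b 1 + b 2) + (b 0 + b 2) = b
0 + b 1` modulo 2. -/
theorem hasPotential_iff (b : Fin 3 → ZMod 2) : G.HasPotential b ↔
    ∃ φ : Flag E → ZMod 2, ∀ x, φ (G.flip Color.v x) = φ x + (b 1 + b 2) ∧
      φ (G.flip Color.f x) = φ x + (b 0 + b 2) ∧
      φ (G.flip Color.a x) = φ x + (b 0 + b 1 + b 2) := by
  refine exists_congr fun φ => ⟨fun h x => ⟨h _ x, h _ x, h _ x⟩, ?_⟩
  rintro h (_ | _ | _ | _) x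
  · exact (h x).1
  · exact (h x).2.1
  · rw [flip_z, (h _).1, (h x).2.1]
    have h2 : b 2 + b 2 = 0 := CharTwo.add_self_eq_zero _
    simp only [colorWeight]
    linear_combination h2
  · exact (h x).2.2

theorem root_rot (h : HalfEdge E) : G.root (G.rot h) = G.root h :=
  (G.sameCycle_rot_iff _ _).1 (Equiv.Perm.sameCycle_apply_left.2 (Equiv.Perm.SameCycle.refl _ _))

theorem root_rot_inv (h : HalfEdge E) : G.root (G.rot⁻¹ h) = G.root h := by
  simpa using (G.root_rot (G.rot⁻¹ h)).symm

theorem root_flip_a (x : Flag E) : G.root (G.flip Color.a x).1 = G.root x.1 := by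
  simp only [flip]
  split_ifs
  · exact G.root_rot _
  · exact G.root_rot_inv _

/-- A function of the half-edges that is constant along `rot` is a function of their roots. -/
theorem eq_of_root_eq {γ : Type*} (g : HalfEdge E → γ) (hg : ∀ h, g (G.rot h) = g h)
    {h k : HalfEdge E} (hk : G.root h = G.root k) : g h = g k := by
  obtain ⟨n, rfl⟩ := (G.sameCycle_rot_iff h k).2 hk
  induction n using Int.induction_on with
  | zero => simp
  | succ n ih =>
    have h1 : G.root h = G.root ((G.rot ^ (n : ℤ)) h) :=
      (G.sameCycle_rot_iff _ _).1 ⟨_, rfl⟩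
    rw [add_comm, zpow_add, zpow_one, Equiv.Perm.mul_apply, hg]
    exact ih h1
  | pred n ih =>
    have h1 : G.root h = G.root ((G.rot ^ (-n : ℤ)) h) :=
      (G.sameCycle_rot_iff _ _).1 ⟨_, rfl⟩
    rw [ih h1, ← hg ((G.rot ^ (-n - 1 : ℤ)) h), ← Equiv.Perm.mul_apply, ← zpow_one_add]
    congr 3
    ring

theorem exists_vertex_function {γ : Type*} [Nonempty γ] (g : HalfEdge E → γ)
    (hg : ∀ h, g (G.rot h) = g h) : ∃ o : V → γ, ∀ h, o (G.root h) = g h := by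
  classical
  -- A vertex without half-edges gets an arbitrary value; nothing constrains it.
  refine ⟨fun u => if hu : ∃ h, G.root h = u then g hu.choose else Classical.arbitrary γ, ?_⟩
  intro h
  have hu : ∃ k, G.root k = G.root h := ⟨h, rfl⟩
  simp only [hu, dif_pos]
  exact G.eq_of_root_eq g hg hu.choose_spec

theorem flip_a_one (h : HalfEdge E) : G.flip Color.a (h, 1) = (G.rot h, -1) := rfl

/-! ### Signs -/

/-- The exponent of `-1` in a sign. -/
def signParity (u : ℤˣ) : ZMod 2 := if u = 1 then 0 else 1

theorem signParity_mul (u w : ℤˣ) : signParity (u * w) = signParity u + signParity w := by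
  revert u w; decide

theorem signParity_neg (u : ℤˣ) : signParity (-u) = signParity u + 1 := by
  revert u; decide

theorem signParity_inj {u w : ℤˣ} : signParity u = signParity w ↔ u = w := by
  revert u w; decide

theorem signParity_surjective : Function.Surjective signParity := by
  unfold Function.Surjective; decide

theorem signParity_list_prod (l : List ℤˣ) : signParity l.prod = (l.map signParity).sum := by
  induction l with
  | nil => rfl
  | cons u l ih => simp [signParity_mul, ih]

/-! ### The seven properties as existence of potentials -/

/-- Local orientations along which all products of signs are `c` amount to a potential. -/
theorem exists_orientation_iff (c : ℤˣ) :
    (∃ o : V → ZMod 2, ∀ e x y, G.graph.IsLink e x y →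
      o y = o x + (signParity (G.sign e) + signParity c)) ↔
    ∃ φ : Flag E → ZMod 2, ∀ x, φ (G.flip Color.v x) = φ x + 1 ∧
      φ (G.flip Color.f x) = φ x + (1 + signParity c) ∧ φ (G.flip Color.a x) = φ x + 1 := by
  have two : (2 : ZMod 2) = 0 := by decide
  constructor
  · rintro ⟨o, ho⟩
    -- Changing the local orientation at a vertex swaps the two sides of each half-edge there, so
    -- the side is recorded relative to the orientation `o`.
    refine ⟨fun x => o (G.root x.1) + signParity x.2, fun x => ⟨?_, ?_, ?_⟩⟩
    · simp only [flip, signParity_neg]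
      ring
    · have h := ho x.1.1 (G.root x.1) (G.root x.1.opp) ⟨x.1.2, rfl, rfl⟩
      simp only [flip, signParity_neg, signParity_mul, h]
      linear_combination signParity (G.sign x.1.1) * two
    · simp only [root_flip_a]
      obtain ⟨h, s⟩ := x
      rcases Int.units_eq_one_or s with rfl | rfl
      · simp [flip, signParity]
      · simp [flip, signParity, CharTwo.add_self_eq_zero, add_assoc]
  · rintro ⟨φ, hφ⟩
    have hs : ∀ h s, φ (h, s) = φ (h, 1) + signParity s := by
      intro h s
      rcases Int.units_eq_one_or s with rfl | rfl
      · simp [signParity]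
      · simpa [flip, signParity] using (hφ (h, 1)).1
    -- Color `a` leads from side `1` of `h` to side `-1` of `rot h`. The change of `φ` across this
    -- corner and the change of side cancel, so `φ (h, 1)` is constant around the vertex.
    obtain ⟨o, ho⟩ := G.exists_vertex_function (fun h => φ (h, 1)) (by
      intro h
      have h1 := (hφ (h, 1)).2.2
      rw [flip_a_one, hs, signParity_neg] at h1
      simpa [signParity] using h1)
    refine ⟨o, ?_⟩
    rintro e x y ⟨i, rfl, rfl⟩
    have h1 := (hφ ((e, i), 1)).2.1
    simp only [flip, HalfEdge.opp, one_mul] at h1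
    rw [hs, signParity_neg] at h1
    rw [ho, ho]
    linear_combination h1 - signParity (G.sign e) * two

/-- All three changes are `1`: an orientation is a proper 2-coloring of the triangles of the
barycentric subdivision. -/
theorem orientable_iff : G.Orientable ↔ G.HasPotential (binVec 1) := by
  have hb : binVec 1 = ![0, 0, 1] := by decide
  have h := G.exists_orientation_iff 1
  rw [hasPotential_iff, hb]
  simp only [show signParity 1 = 0 from rfl, add_zero] at h
  simp only [Matrix.cons_val, zero_add, add_zero]
  rw [← h]
  constructor
  · rintro ⟨o, ho⟩
    refine ⟨fun u => signParity (o u), fun e x y hl => ?_⟩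
    rw [← signParity_mul, signParity_inj]
    have := ho e x y hl
    exact (mul_eq_one_iff_inv_eq.1 this).symm.trans (Int.units_inv_eq_self _)
  · rintro ⟨o, ho⟩
    choose g hg using signParity_surjective
    refine ⟨fun u => g (o u), fun e x y hl => ?_⟩
    rw [← signParity_inj, signParity_mul, signParity_mul, hg, hg, ho e x y hl]
    exact CharTwo.add_self_eq_zero _

/-- Being 1-sided and having odd length are both parities, and they agree exactly when their sum is
even. -/
theorem oneSided_iff_odd_iff {u : V} (C : Walk G.graph u u) :
    (G.OneSided C ↔ Odd C.edges.length) ↔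
      C.weight (fun e => signParity (G.sign e) + signParity (-1)) = 0 := by
  have h1 : C.weight (fun e => signParity (G.sign e) + signParity (-1)) =
      signParity (C.edges.map G.sign).prod + (C.edges.length : ZMod 2) := by
    rw [Walk.weight, List.sum_map_add, signParity_list_prod, List.map_map]
    simp [signParity, Function.comp_def]
  rw [h1, OneSided, ← ZMod.natCast_eq_one_iff_odd]
  generalize (C.edges.map G.sign).prod = s
  generalize (C.edges.length : ZMod 2) = n
  revert s n
  decide

theorem oneSidedIffOdd_iff : G.OneSidedIffOdd ↔ G.HasPotential (binVec 2) := by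
  have hb : binVec 2 = ![0, 1, 0] := by decide
  have h := G.exists_orientation_iff (-1)
  have h0 : (1 : ZMod 2) + signParity (-1) = 0 := by decide
  rw [h0] at h
  rw [hasPotential_iff, hb]
  simp only [Matrix.cons_val, zero_add, add_zero] at h ⊢
  rw [← h, ← Walk.closed_weight_zero_iff_potential]
  unfold OneSidedIffOdd
  simp_rw [oneSided_iff_odd_iff]
  -- The potential on the vertices controls all closed walks of the graph, while the property
  -- mentions only cycles.
  exact ⟨Walk.closed_weight_zero_of_cycles _, fun h u C _ => h u C⟩

/-- Colors `false` and `true` as elements of `ℤ₂`. -/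
def bit (i : Bool) : ZMod 2 := if i then 1 else 0

theorem bit_ne {i j : Bool} : i ≠ j ↔ bit j = bit i + 1 := by
  revert i j; decide

theorem decide_ne {m n : ZMod 2} : decide (m = 1) ≠ decide (n = 1) ↔ n = m + 1 := by
  revert m n; decide

/-- A potential that changes across `f` only is constant around each vertex and differs at the two
ends of each edge. -/
theorem bipartite_iff : Bipartite G.graph ↔ G.HasPotential (binVec 3) := by
  have hb : binVec 3 = ![0, 1, 1] := by decide
  rw [hasPotential_iff, hb]
  simp only [Matrix.cons_val, zero_add, CharTwo.add_self_eq_zero, add_zero]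
  constructor
  · rintro ⟨col, hcol⟩
    refine ⟨fun x => bit (col (G.root x.1)), fun x => ⟨rfl, ?_, by simp only [root_flip_a]⟩⟩
    exact bit_ne.1 (hcol x.1.1 _ _ ⟨x.1.2, rfl, rfl⟩)
  · rintro ⟨φ, hφ⟩
    have hs : ∀ h s, φ (h, s) = φ (h, 1) := by
      intro h s
      rcases Int.units_eq_one_or s with rfl | rfl
      · rfl
      · exact (hφ (h, 1)).1
    obtain ⟨o, ho⟩ := G.exists_vertex_function (fun h => φ (h, 1)) fun h =>
      (hs _ _).symm.trans (hφ (h, 1)).2.2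
    refine ⟨fun u => decide (o u = 1), ?_⟩
    rintro e x y ⟨i, rfl, rfl⟩
    rw [decide_ne, ho, ho]
    exact (hs _ _).symm.trans (hφ ((e, i), 1)).2.1

theorem facialWalk_one (x : Flag E) :
    G.facialWalk x 1 = (G.flip Color.a (G.flip Color.f x)).1 := rfl

/-- The potential tells whether a half-edge is the head or the tail of its edge. It changes across
`f` and again across `a`, hence it is constant along a facial walk, each step of which is `f`
followed by `a`. -/
theorem directable_iff : G.Directable ↔ G.HasPotential (binVec 4) := by
  have hb : binVec 4 = ![1, 0, 0] := by decide
  rw [hasPotential_iff, hb]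
  simp only [Matrix.cons_val, add_zero]
  constructor
  · rintro ⟨tail, ht⟩
    have hf : ∀ x, bit ((G.flip Color.f x).1.2 ^^ tail (G.flip Color.f x).1.1) =
        bit (x.1.2 ^^ tail x.1.1) + 1 := by
      rintro ⟨⟨e, i⟩, s⟩
      simp only [flip, HalfEdge.opp]
      generalize tail e = t
      revert i t
      decide
    refine ⟨fun x => bit (x.1.2 ^^ tail x.1.1), fun x => ⟨rfl, hf x, ?_⟩⟩
    rw [← hf]
    dsimp only
    -- Starting at `G.flip Color.f x` makes the corner at `x` the first one that the facial walk
    -- turns.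
    have h0 : G.facialWalk (G.flip Color.f x) 0 = (G.flip Color.f x).1 := rfl
    have h1 : G.facialWalk (G.flip Color.f x) 1 = (G.flip Color.a x).1 := by
      rw [facialWalk_one, flip_flip]
    rcases ht (G.flip Color.f x) with h | h
    · have a0 := h 0
      have a1 := h 1
      rw [h0] at a0
      rw [h1] at a1
      rw [a0, a1, Bool.xor_self, Bool.xor_self]
    · have a0 := h 0
      have a1 := h 1
      rw [h0, ← Bool.eq_not] at a0
      rw [h1, ← Bool.eq_not] at a1
      rw [a0, a1, Bool.not_xor_self, Bool.not_xor_self]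
  · rintro ⟨φ, hφ⟩
    have hs : ∀ h s, φ (h, s) = φ (h, 1) := by
      intro h s
      rcases Int.units_eq_one_or s with rfl | rfl
      · rfl
      · exact (hφ (h, 1)).1
    have ho : ∀ e, φ ((e, true), 1) = φ ((e, false), 1) + 1 := fun e =>
      (hs _ _).symm.trans (hφ ((e, false), 1)).2.1
    have key : ∀ x : Flag E, (x.1.2 = decide (φ ((x.1.1, true), 1) = 1)) ↔ φ x = 1 := by
      rintro ⟨⟨e, i⟩, s⟩
      have h := ho e
      rw [hs _ s]
      clear * - h
      revert h
      cases i <;> simp only <;> generalize φ ((e, true), 1) = m <;>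
        generalize φ ((e, false), 1) = n <;> revert m n <;> decide
    have hc : ∀ x n, φ ((fun y => G.flip Color.a (G.flip Color.f y))^[n] x) = φ x := by
      intro x n
      induction n with
      | zero => rfl
      | succ n ih =>
        rw [Function.iterate_succ_apply', (hφ _).2.2, (hφ _).2.1, ih, add_assoc,
          CharTwo.add_self_eq_zero, add_zero]
    -- Here tails are the half-edges with potential `1`; the opposite convention above differs by a
    -- constant, which is harmless.
    refine ⟨fun e => decide (φ ((e, true), 1) = 1), fun x => ?_⟩
    by_cases hx : φ x = 1
    · exact Or.inl fun n => (key _).2 ((hc x n).trans hx)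
    · exact Or.inr fun n h => hx ((hc x n).symm.trans ((key _).1 h))

theorem twoFaceColorable_iff : G.TwoFaceColorable ↔ G.HasPotential (binVec 5) := by
  have hb : binVec 5 = ![1, 0, 1] := by decide
  rw [hasPotential_iff, hb]
  simp only [Matrix.cons_val, zero_add, CharTwo.add_self_eq_zero, add_zero]
  constructor
  · rintro ⟨col, hcol⟩
    refine ⟨fun x => bit (col (G.faceOf x)), fun x => ⟨bit_ne.1 (hcol x), ?_, ?_⟩⟩
    · have h : G.faceOf x = G.faceOf (G.flip Color.f x) :=
        congrArg Sum.inl (Quot.sound (Or.inl rfl))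
      simp only [h]
    · have h : G.faceOf x = G.faceOf (G.flip Color.a x) :=
        congrArg Sum.inl (Quot.sound (Or.inr rfl))
      simp only [h]
  · rintro ⟨φ, hφ⟩
    -- The face around a vertex without half-edges borders no edge, so any color will do.
    refine ⟨Sum.elim (Quot.lift (fun x => decide (φ x = 1)) ?_) fun _ => true, fun x => ?_⟩
    · rintro x y (rfl | rfl)
      · rw [(hφ x).2.1]
      · rw [(hφ x).2.2]
    · exact decide_ne.2 (hφ x).1

theorem regionsTwoColorable_iff : G.RegionsTwoColorable ↔ G.HasPotential (binVec 6) := by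
  have hb : binVec 6 = ![1, 1, 0] := by decide
  rw [hasPotential_iff, hb]
  simp only [Matrix.cons_val, CharTwo.add_self_eq_zero, add_zero]
  constructor
  · rintro ⟨col, hcol⟩
    refine ⟨fun x => bit (col (G.regionOf x)), fun x =>
      ⟨bit_ne.1 (hcol x).1, bit_ne.1 (hcol x).2, ?_⟩⟩
    have h : G.regionOf x = G.regionOf (G.flip Color.a x) :=
      congrArg Sum.inl (Quot.sound rfl)
    simp only [h]
  · rintro ⟨φ, hφ⟩
    refine ⟨Sum.elim (Quot.lift (fun x => decide (φ x = 1)) ?_) fun _ => true, fun x => ?_⟩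
    · rintro x y rfl
      rw [(hφ x).2.2]
    · exact ⟨decide_ne.2 (hφ x).1, decide_ne.2 (hφ x).2.1⟩

theorem alternatingEdgeColorable_iff :
    G.AlternatingEdgeColorable ↔ G.HasPotential (binVec 7) := by
  have hb : binVec 7 = ![1, 1, 1] := by decide
  rw [hasPotential_iff, hb]
  simp only [Matrix.cons_val, CharTwo.add_self_eq_zero, add_zero, zero_add]
  constructor
  · rintro ⟨col, hv, -⟩
    refine ⟨fun x => bit (col x.1.1), ?_⟩
    rintro ⟨h, s⟩
    refine ⟨rfl, rfl, bit_ne.1 ?_⟩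
    rcases Int.units_eq_one_or s with rfl | rfl
    · exact hv h
    · have := hv (G.rot⁻¹ h)
      exact (by simpa using this : col (G.rot⁻¹ h).1 ≠ col h.1).symm
  · rintro ⟨φ, hφ⟩
    have hs : ∀ x : Flag E, φ x = φ ((x.1.1, true), 1) := by
      have hs' : ∀ h s, φ (h, s) = φ (h, 1) := by
        intro h s
        rcases Int.units_eq_one_or s with rfl | rfl
        · rfl
        · exact (hφ (h, 1)).1
      rintro ⟨⟨e, i⟩, s⟩
      rw [hs']
      cases i
      · exact (hφ ((e, false), 1)).2.1.symm.trans (hs' _ _)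
      · rfl
    have ha : ∀ x : Flag E, φ ((((G.flip Color.a x).1.1, true), 1)) =
        φ ((x.1.1, true), 1) + 1 := fun x => by
      rw [← hs, ← hs, (hφ x).2.2]
    refine ⟨fun e => decide (φ ((e, true), 1) = 1), fun h => ?_, fun x n => ?_⟩
    · exact decide_ne.2 (ha (h, 1))
    · rw [decide_ne, facialWalk, facialWalk, Function.iterate_succ_apply']
      -- The move across `f` stays on the same edge, so only the move across `a` changes the color.
      exact ha (G.flip Color.f _)

theorem property_iff (p : Fin 8) : G.Property p ↔ binVec p ∈ G.potentialSpace := by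
  rw [mem_potentialSpace]
  fin_cases p
  · have hb : binVec 0 = 0 := by decide
    exact iff_of_true trivial (hb ▸ G.potentialSpace.zero_mem)
  · exact G.orientable_iff
  · exact G.oneSidedIffOdd_iff
  · exact G.bipartite_iff
  · exact G.directable_iff
  · exact G.twoFaceColorable_iff
  · exact G.regionsTwoColorable_iff
  · exact G.alternatingEdgeColorable_iff

end EmbeddedGraph

/-! ### Subspaces of the Fano plane -/

theorem binVec_bijective : Function.Bijective binVec := by
  unfold Function.Bijective Function.Injective Function.Surjective
  decide

theorem binVec_eq_zero_iff {p : Fin 8} : binVec p = 0 ↔ p = 0 := by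
  revert p; decide

/-- The zero subspace gives the empty projective subspace, of dimension `-1`. -/
theorem isProjectiveSubspace_sdiff_zero (W : Submodule (ZMod 2) (Fin 3 → ZMod 2)) :
    ∃ d, IsProjectiveSubspace d ((W : Set (Fin 3 → ZMod 2)) \ {0}) :=
  ⟨Module.finrank (ZMod 2) W - 1, W, by ring, rfl⟩

theorem image_binVec (W : Submodule (ZMod 2) (Fin 3 → ZMod 2)) :
    binVec '' {p | p ≠ 0 ∧ binVec p ∈ W} = (W : Set (Fin 3 → ZMod 2)) \ {0} := by
  ext b
  obtain ⟨p, rfl⟩ := binVec_bijective.2 b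
  rw [binVec_bijective.1.mem_set_image]
  simp [binVec_eq_zero_iff, and_comm]

theorem ncard_binVec (W : Submodule (ZMod 2) (Fin 3 → ZMod 2)) :
    {p | p ≠ 0 ∧ binVec p ∈ W}.ncard = 2 ^ Module.finrank (ZMod 2) W - 1 := by
  rw [← Set.ncard_image_of_injective _ binVec_bijective.1, image_binVec,
    Set.ncard_sdiff_singleton_of_mem W.zero_mem]
  congr 1
  have h := Module.natCard_eq_pow_finrank (K := ZMod 2) (V := W)
  rw [Nat.card_zmod] at h
  exact h

theorem binVec_mem_of_xor_eq_zero (W : Submodule (ZMod 2) (Fin 3 → ZMod 2)) (a b c : Fin 8)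
    (h : a.val ^^^ b.val ^^^ c.val = 0) (ha : binVec a ∈ W) (hb : binVec b ∈ W) :
    binVec c ∈ W := by
  have key : ∀ a b c : Fin 8, a.val ^^^ b.val ^^^ c.val = 0 →
      binVec c = binVec a + binVec b := by decide
  rw [key a b c h]
  exact W.add_mem ha hb

theorem finrank_fano (W : Submodule (ZMod 2) (Fin 3 → ZMod 2)) :
    Module.finrank (ZMod 2) W ≤ 3 := by
  simpa using W.finrank_le

/-- A proper subspace has dimension at most `2`, hence at most three nonzero vectors. -/
theorem eq_top_of_four_le_ncard (W : Submodule (ZMod 2) (Fin 3 → ZMod 2))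
    (h : 4 ≤ {p | p ≠ 0 ∧ binVec p ∈ W}.ncard) : W = ⊤ := by
  rw [ncard_binVec] at h
  apply Submodule.eq_top_of_finrank_eq
  have h3 := finrank_fano W
  rw [Module.finrank_fin_fun]
  generalize Module.finrank (ZMod 2) W = d at *
  interval_cases d <;> simp_all

/-- The line through `a` and `b` has a third point `d`, which differs from `c` because `c` is off
that line. Thus `a`, `b`, `c`, `d` are four points of `W`. -/
theorem four_le_ncard_of_xor_ne_zero (W : Submodule (ZMod 2) (Fin 3 → ZMod 2)) (a b c : Fin 8)
    (ha0 : a ≠ 0) (hb0 : b ≠ 0) (hc0 : c ≠ 0) (hab : a ≠ b) (hac : a ≠ c) (hbc : b ≠ c)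
    (h : a.val ^^^ b.val ^^^ c.val ≠ 0) (ha : binVec a ∈ W) (hb : binVec b ∈ W)
    (hc : binVec c ∈ W) : 4 ≤ {p | p ≠ 0 ∧ binVec p ∈ W}.ncard := by
  have key : ∀ a b : Fin 8, a ≠ b → b ≠ 0 → a ≠ 0 →
      ∃ d : Fin 8, d ≠ 0 ∧ d ≠ a ∧ d ≠ b ∧ a.val ^^^ b.val ^^^ d.val = 0 := by decide
  obtain ⟨d, hd0, hda, hdb, hd⟩ := key a b hab hb0 ha0
  have hdc : d ≠ c := by
    rintro rfl
    exact h hd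
  have hdW := binVec_mem_of_xor_eq_zero W a b d hd ha hb
  have hsub : (({a, b, c, d} : Finset (Fin 8)) : Set (Fin 8)) ⊆
      {p | p ≠ 0 ∧ binVec p ∈ W} := by
    intro p hp
    simp only [Finset.coe_insert, Finset.coe_singleton, Set.mem_insert_iff,
      Set.mem_singleton_iff] at hp
    rcases hp with rfl | rfl | rfl | rfl
    exacts [⟨ha0, ha⟩, ⟨hb0, hb⟩, ⟨hc0, hc⟩, ⟨hd0, hdW⟩]
  have hle := Set.ncard_le_ncard hsub (Set.toFinite _)
  have hcard : ({a, b, c, d} : Finset (Fin 8)).card = 4 := by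
    rw [Finset.card_eq_succ]
    refine ⟨a, {b, c, d}, by simp [hab, hac, hda.symm], rfl, ?_⟩
    rw [Finset.card_eq_three]
    exact ⟨b, c, d, hbc, hdb.symm, hdc.symm, rfl⟩
  rwa [Set.ncard_coe_finset, hcard] at hle

theorem exists_third_binVec_mem (W : Submodule (ZMod 2) (Fin 3 → ZMod 2)) (a b : Fin 8)
    (ha0 : a ≠ 0) (hb0 : b ≠ 0) (hab : a ≠ b) (ha : binVec a ∈ W) (hb : binVec b ∈ W) :
    ∃ c, c ≠ 0 ∧ c ≠ a ∧ c ≠ b ∧ binVec c ∈ W := by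
  have key : ∀ a b : Fin 8, a ≠ b → b ≠ 0 → a ≠ 0 →
      ∃ d : Fin 8, d ≠ 0 ∧ d ≠ a ∧ d ≠ b ∧ a.val ^^^ b.val ^^^ d.val = 0 := by decide
  obtain ⟨c, hc0, hca, hcb, h⟩ := key a b hab hb0 ha0
  exact ⟨c, hc0, hca, hcb, binVec_mem_of_xor_eq_zero W a b c h ha hb⟩

end FanoFramework

theorem mainTheorem1 :
    -- the map from property numbers to vectors takes the seven properties to the seven points
    Set.BijOn FanoFramework.binVec {p | p ≠ 0} {b | b ≠ 0} ∧
    ∀ {V E : Type*} [Finite V] [Finite E] (G : FanoFramework.EmbeddedGraph V E),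
      -- every property is equivalent to its closed walk condition in the jewel
      (∀ p, G.Property p ↔ G.jewel.ClosedWalkCondition (FanoFramework.binVec p)) ∧
      -- the vectors whose condition holds form a vector subspace, and a projective subspace
      (∃ X : Submodule (ZMod 2) (Fin 3 → ZMod 2),
        (X : Set (Fin 3 → ZMod 2)) = {b | G.jewel.ClosedWalkCondition b}) ∧
      (∃ d, FanoFramework.IsProjectiveSubspace d
        ({b | G.jewel.ClosedWalkCondition b} \ {0})) ∧
      -- the properties that hold form a projective subspace
      (∃ d, FanoFramework.IsProjectiveSubspace d
        (FanoFramework.binVec '' {p | p ≠ 0 ∧ G.Property p})) ∧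
      -- exactly zero, one, three or seven of the seven properties hold
      {p | p ≠ 0 ∧ G.Property p}.ncard ∈ ({0, 1, 3, 7} : Set ℕ) ∧
      (∀ a b, a ≠ 0 → b ≠ 0 → a ≠ b → G.Property a → G.Property b →
        ∃ c, c ≠ 0 ∧ c ≠ a ∧ c ≠ b ∧ G.Property c) ∧
      (4 ≤ {p | p ≠ 0 ∧ G.Property p}.ncard → ∀ p, G.Property p) ∧
      -- two of three properties on a line imply the third
      (∀ a b c : Fin 8, a ≠ 0 → b ≠ 0 → c ≠ 0 → a ≠ b → a ≠ c → b ≠ c →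
        a.val ^^^ b.val ^^^ c.val = 0 → G.Property a → G.Property b → G.Property c) ∧
      -- three properties that are not on a line imply all of them
      (∀ a b c : Fin 8, a ≠ 0 → b ≠ 0 → c ≠ 0 → a ≠ b → a ≠ c → b ≠ c →
        a.val ^^^ b.val ^^^ c.val ≠ 0 → G.Property a → G.Property b → G.Property c →
        ∀ p, G.Property p) := by
  refine ⟨⟨fun p hp => mt FanoFramework.binVec_eq_zero_iff.1 hp,
    FanoFramework.binVec_bijective.1.injOn, fun b hb => ?_⟩, ?_⟩
  · obtain ⟨p, rfl⟩ := FanoFramework.binVec_bijective.2 b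
    exact ⟨p, mt FanoFramework.binVec_eq_zero_iff.2 hb, rfl⟩
  intro V E _ _ G
  have hX : {b | G.jewel.ClosedWalkCondition b} = (G.potentialSpace : Set (Fin 3 → ZMod 2)) :=
    Set.ext G.closedWalkCondition_iff_hasPotential
  refine ⟨fun p => (G.property_iff p).trans
    (G.closedWalkCondition_iff_hasPotential _).symm, ⟨G.potentialSpace, hX.symm⟩, ?_⟩
  rw [hX]
  simp_rw [FanoFramework.EmbeddedGraph.property_iff]
  -- The graph plays no further part: the remaining claims hold for every subspace `W`.
  generalize G.potentialSpace = W
  refine ⟨FanoFramework.isProjectiveSubspace_sdiff_zero W, ?_, ?_,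
    FanoFramework.exists_third_binVec_mem W, ?_, ?_, ?_⟩
  · rw [FanoFramework.image_binVec]
    exact FanoFramework.isProjectiveSubspace_sdiff_zero W
  · rw [FanoFramework.ncard_binVec]
    have h := FanoFramework.finrank_fano W
    generalize Module.finrank (ZMod 2) W = d at h
    interval_cases d <;> simp
  · intro h p
    rw [FanoFramework.eq_top_of_four_le_ncard W h]
    trivial
  · intro a b c _ _ _ _ _ _ h ha hb
    exact FanoFramework.binVec_mem_of_xor_eq_zero W a b c h ha hb
  · intro a b c ha0 hb0 hc0 hab hac hbc h ha hb hc p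
    rw [FanoFramework.eq_top_of_four_le_ncard W
      (FanoFramework.four_le_ncard_of_xor_ne_zero W a b c ha0 hb0 hc0 hab hac hbc h ha hb hc)]
    trivial
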